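/- Let $R$ be a polynomial ring in finitely many variables over a field $K$, let $f_1,\dots,f_m\in R$, let $\le$ be a monomial order on $R$ (a multiplicative well-order of the monomials) and a compatible module monomial order on $R^m$ (a well-order of the module monomials with $S\le T\Rightarrow cS\le cT$ for monomials $c$, and $a\le b\iff ae_i\le be_i$). For $\alpha=\sum a_ie_i\in R^m$ put $\overline\alpha=\sum a_if_i$; the signature $\mathfrak s(\alpha)$ is the largest term of $\alpha$, with coefficient. Monomials may carry nonzero coefficients, and $\simeq$ is equality up to a nonzero scalar. Signatures are compared by $\le$ disregarding coefficients. *Reduction.* For $G\subseteq R^m$, a regular reduction step modulo $G$ replaces $\alpha$ by $\alpha-b\beta$, where $\beta\in G$, $b$ is a monomial, the lead term of $\overline{b\beta}$ equals some term of $\overline\alpha$ (lead or tail), $\mathfrak s(b\beta)\le\mathfrak s(\alpha)$ and $\mathfrak s(b\beta)\not\simeq\mathfrak s(\alpha)$. The result of regular reducing $\alpha$ is an element reached by such steps that admits no further one. $\gamma$ is singular top reducible modulo $G$ if there are $\beta\in G$ and a monomial $b$ such that the lead terms of $\overline{b\beta}$ and $\overline\gamma$ agree and $\mathfrak s(b\beta)\simeq\mathfrak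 s(\gamma)$. *S-pairs.* If $\overline\alpha,\overline\beta\ne0$ and $\lambda$ is the monic least common multiple of their lead terms, the S-pair of $\alpha,\beta$ is $a\alpha-b\beta$ with $a=\lambda/\mathrm{lt}(\overline\alpha)$, $b=\lambda/\mathrm{lt}(\overline\beta)$; it is regular if $\mathfrak s(a\alpha)\not\simeq\mathfrak s(b\beta)$. *genSB.* Start with $G=H=\emptyset$, $P=\{e_1,\dots,e_m\}$. While $P\neq\emptyset$, remove from $P$ an element of least signature and regular reduce it modulo $G$ to $\gamma$. If $\overline\gamma=0$, add $\gamma$ to $H$. Otherwise, if $\gamma$ is not singular top reducible modulo $G$, add to $P$ all regular S-pairs between elements of $G$ and $\gamma$, and then add $\gamma$ to $G$. Return $(G,H)$. *RB.* It has as additional input an order $\trianglelefteq$ on $G\cup H$. An element $\alpha\in G\cup H$ is a rewriter in signature $T$ if $\mathfrak s(a\alpha)=T$ for some monomial $a$; a multiple $a\alpha$ is rewritable if $\alpha$ is not $\trianglelefteq$-maximal among the rewriters in signature $\mathfrak s(a\alpha)$; an S-pair $a\alpha-b\beta$ is rewritable if $a\alpha$ or $b\beta$ is; the $e_i$ are not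 rewritable. RB starts with $G=\emptyset$, $H=\{f_ie_j-f_je_i : i<j\}$, $P=\{e_1,\dots,e_m\}$. While $P\ne\emptyset$, remove from $P$ an element of least signature. If it is rewritable, discard it; otherwise regular reduce it modulo $G$ to $\gamma$. If $\overline\gamma=0$, add $\gamma$ to $H$; otherwise add to $P$ all regular S-pairs between elements of $G$ and $\gamma$, and then add $\gamma$ to $G$. Return $(G,H)$. In both algorithms, ties between elements of $P$ of equal signature, and choices between reducers, may be resolved in any way. **Lemma.** Let $(G,H)$ be returned by genSB and $(G',H')$ by RB, for the same $f_1,\dots,f_m$ and the same $\le$. Assume that the order $\trianglelefteq$ used by RB is a rewrite order, i.e. a partial order on $G'\cup H'$ which is total on $G'$, and that it is admissible: whenever a regular S-pair $a\alpha-b\beta$ with $\alpha,\beta\in G'$ reduces by regular reduction steps modulo $G'$ to $\gamma\in G'$, then $\alpha\trianglelefteq\gamma$ if $\mathfrak s(a\alpha)>\mathfrak s(b\beta)$, and $\beta\trianglelefteq\gamma$ if $\mathfrak s(b\beta)>\mathfrak s(a\alpha)$. Then $G$ is a subset of $G'$ up to sig-poly pairs: for every $\alpha\in G$ there are $\beta\in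 G'$ and a nonzero $\kappa\in K$ with $\mathfrak s(\alpha)=\mathfrak s(\kappa\beta)$ and $\overline\alpha=\overline{\kappa\beta}$. -/

import Mathlib

noncomputable section

namespace SigGB

open MvPolynomial

/-- The free module `R ^ m` over the polynomial ring `R = K[σ]`. -/
abbrev FreeMod (σ K : Type*) [Field K] (m : ℕ) : Type _ := Fin m → MvPolynomial σ K

/-- A module monomial order on the free module of rank `m` over a polynomial ring, compatible with
the monomial order `ord`. The pair `(i, a)` stands for the monic module monomial `x ^ a * e_i`. -/
structure ModuleOrder {σ : Type*} (ord : MonomialOrder σ) (m : ℕ) where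
  /-- the strict order on monic module monomials -/
  lt : Fin m × (σ →₀ ℕ) → Fin m × (σ →₀ ℕ) → Prop
  isWellOrder : IsWellOrder (Fin m × (σ →₀ ℕ)) lt
  mul_lt : ∀ (c : σ →₀ ℕ) (i j : Fin m) (a b : σ →₀ ℕ),
    lt (i, a) (j, b) → lt (i, c + a) (j, c + b)
  compatible : ∀ (i : Fin m) (a b : σ →₀ ℕ), lt (i, a) (i, b) ↔ ord.toSyn a < ord.toSyn b

section Signatures

variable {σ K : Type*} [Field K] {m : ℕ} {ord : MonomialOrder σ}

/-- The monic module monomials, linearly ordered by `o`. -/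
def ModuleOrder.Mon (_o : ModuleOrder ord m) : Type _ := Fin m × (σ →₀ ℕ)

instance (o : ModuleOrder ord m) : LinearOrder o.Mon :=
  letI : IsWellOrder o.Mon o.lt := o.isWellOrder
  IsWellOrder.linearOrder (α := o.Mon) o.lt

/-- The monic module monomial `x ^ a * e_i`, as an element of the linear order `o.Mon`. -/
def ModuleOrder.mon (o : ModuleOrder ord m) (i : Fin m) (a : σ →₀ ℕ) : o.Mon := (i, a)

/-- The monic module monomial of the signature of `α` (`⊥` if `α = 0`): the largest one
that occurs in `α`. Inequalities between signatures are inequalities between these. -/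
def ModuleOrder.sigMon (o : ModuleOrder ord m) (α : FreeMod σ K m) : WithBot o.Mon :=
  Finset.univ.sup fun i => (α i).support.sup fun a => ((o.mon i a : o.Mon) : WithBot o.Mon)

/-- The signature of `α`: its largest term, with its coefficient (`0` if `α = 0`). -/
def ModuleOrder.sig (o : ModuleOrder ord m) (α : FreeMod σ K m) : FreeMod σ K m :=
  WithBot.recBotCoe (C := fun _ => FreeMod σ K m) 0
    (fun s : o.Mon => Pi.single s.1 (monomial s.2 ((α s.1).coeff s.2))) (o.sigMon α)

/-- `f ≃ g`: equality up to a nonzero scalar. -/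
def ScalarEq (K : Type*) [Field K] {M : Type*} [SMul K M] (x y : M) : Prop :=
  ∃ κ : K, κ ≠ 0 ∧ x = κ • y

/-- The homomorphism from the free module to `R` that sends `e_i` to `f_i`. -/
def proj (f : Fin m → MvPolynomial σ K) (α : FreeMod σ K m) : MvPolynomial σ K :=
  ∑ i, α i * f i

/-- `α` and `β` are equal up to sig-poly pairs. -/
def EqUpToSigPoly (f : Fin m → MvPolynomial σ K) (o : ModuleOrder ord m)
    (α β : FreeMod σ K m) : Prop :=
  ∃ κ : K, κ ≠ 0 ∧ o.sig α = o.sig (κ • β) ∧ proj f α = proj f (κ • β)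

/-! ### Reduction respecting signatures -/

/-- `t` is a term of the polynomial `p`. -/
def IsTermOf (t p : MvPolynomial σ K) : Prop :=
  ∃ d ∈ p.support, t = monomial d (p.coeff d)

/-- The multiple `bβ` reduces the term `t` of `proj f α`. -/
def SReducesTerm (f : Fin m → MvPolynomial σ K) (o : ModuleOrder ord m)
    (α : FreeMod σ K m) (t : MvPolynomial σ K) (bβ : FreeMod σ K m) : Prop :=
  IsTermOf t (proj f α) ∧ proj f bβ ≠ 0 ∧ ord.leadingTerm (proj f bβ) = t ∧
    o.sigMon bβ ≤ o.sigMon α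

/-- `bβ` is a multiple of `β` by a (not necessarily monic) monomial. -/
def IsMonomialMultiple (β bβ : FreeMod σ K m) : Prop :=
  ∃ (b : σ →₀ ℕ) (c : K), c ≠ 0 ∧ bβ = monomial b c • β

/-- One regular reduction step (top or tail) with respect to `G`, leading from `α` to `α'`. -/
def RegularStep (f : Fin m → MvPolynomial σ K) (o : ModuleOrder ord m)
    (G : Set (FreeMod σ K m)) (α α' : FreeMod σ K m) : Prop :=
  ∃ β ∈ G, ∃ bβ, IsMonomialMultiple β bβ ∧ (∃ t, SReducesTerm f o α t bβ) ∧
    ¬ ScalarEq K (o.sig bβ) (o.sig α) ∧ α' = α - bβ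

/-- `γ` is a result of regular reducing `α` with respect to `G`: it is reached by regular
reduction steps and admits no further one. -/
def IsRegularReduction (f : Fin m → MvPolynomial σ K) (o : ModuleOrder ord m)
    (G : Set (FreeMod σ K m)) (α γ : FreeMod σ K m) : Prop :=
  Relation.ReflTransGen (RegularStep f o G) α γ ∧ ∀ δ, ¬ RegularStep f o G γ δ

/-- `γ` is singular top reducible with respect to `G`. -/
def SingularTopReducible (f : Fin m → MvPolynomial σ K) (o : ModuleOrder ord m)
    (G : Set (FreeMod σ K m)) (γ : FreeMod σ K m) : Prop :=
  ∃ β ∈ G, ∃ bβ, IsMonomialMultiple β bβ ∧ (∃ t, SReducesTerm f o γ t bβ) ∧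
    ScalarEq K (ord.leadingTerm (proj f bβ)) (ord.leadingTerm (proj f γ)) ∧
    ScalarEq K (o.sig bβ) (o.sig γ)

/-! ### S-pairs -/

/-- The monomial `lcm (lt f, lt g) / lt f` for nonzero polynomials `f` and `g`, where
`lcm (lt f, lt g)` is the monic least common multiple of the lead terms. -/
def cofactor (ord : MonomialOrder σ) (f g : MvPolynomial σ K) : MvPolynomial σ K :=
  monomial (ord.degree f ⊔ ord.degree g - ord.degree f) (ord.leadingCoeff f)⁻¹

/-- The multiple of `α` that occurs in the S-pair of `α` and `β`. -/
def leg (f : Fin m → MvPolynomial σ K) (ord : MonomialOrder σ) (α β : FreeMod σ K m) :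
    FreeMod σ K m :=
  cofactor ord (proj f α) (proj f β) • α

/-- The S-pair of `α` and `β`. -/
def sPair (f : Fin m → MvPolynomial σ K) (ord : MonomialOrder σ) (α β : FreeMod σ K m) :
    FreeMod σ K m :=
  leg f ord α β - leg f ord β α

/-- The S-pair of `α` and `β` is regular. -/
def RegularPair (f : Fin m → MvPolynomial σ K) (o : ModuleOrder ord m)
    (α β : FreeMod σ K m) : Prop :=
  ¬ ScalarEq K (o.sig (leg f ord α β)) (o.sig (leg f ord β α))

/-- The entries of a pair set: unit vectors `e_i`, and S-pairs stored with their two generators. -/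
inductive Pair (σ K : Type*) [Field K] (m : ℕ) where
  | unit (i : Fin m) : Pair σ K m
  | spair (α β : FreeMod σ K m) : Pair σ K m

/-- The module element that an entry of a pair set stands for. -/
def Pair.val (f : Fin m → MvPolynomial σ K) (ord : MonomialOrder σ) :
    Pair σ K m → FreeMod σ K m
  | .unit i => Pi.single i 1
  | .spair α β => sPair f ord α β

/-- The regular S-pairs between elements of `G` and `γ`. -/
def newPairs (f : Fin m → MvPolynomial σ K) (o : ModuleOrder ord m)
    (G : Set (FreeMod σ K m)) (γ : FreeMod σ K m) : Set (Pair σ K m) :=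
  {p | ∃ α ∈ G, RegularPair f o α γ ∧ p = .spair α γ}

/-! ### The algorithms -/

/-- The values of the program variables: the basis `G`, the syzygies `H`, the pair set `P`. -/
structure State (σ K : Type*) [Field K] (m : ℕ) where
  G : Set (FreeMod σ K m)
  H : Set (FreeMod σ K m)
  P : Set (Pair σ K m)

/-- `p` may be chosen next from `P`, when `P` is handled by increasing signature. -/
def IsNext (f : Fin m → MvPolynomial σ K) (o : ModuleOrder ord m)
    (P : Set (Pair σ K m)) (p : Pair σ K m) : Prop :=
  p ∈ P ∧ ∀ q ∈ P, o.sigMon (p.val f ord) ≤ o.sigMon (q.val f ord)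

/-- One pass through the loop of `genSB`, with pairs handled by increasing signature. -/
inductive GenSBStep (f : Fin m → MvPolynomial σ K) (o : ModuleOrder ord m) :
    State σ K m → State σ K m → Prop
  | syzygy (s : State σ K m) (p : Pair σ K m) (γ : FreeMod σ K m) :
      IsNext f o s.P p → IsRegularReduction f o s.G (p.val f ord) γ → proj f γ = 0 →
      GenSBStep f o s ⟨s.G, s.H ∪ {γ}, s.P \ {p}⟩
  | basis (s : State σ K m) (p : Pair σ K m) (γ : FreeMod σ K m) :
      IsNext f o s.P p → IsRegularReduction f o s.G (p.val f ord) γ → proj f γ ≠ 0 →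
      ¬ SingularTopReducible f o s.G γ →
      GenSBStep f o s ⟨s.G ∪ {γ}, s.H, (s.P \ {p}) ∪ newPairs f o s.G γ⟩
  | singular (s : State σ K m) (p : Pair σ K m) (γ : FreeMod σ K m) :
      IsNext f o s.P p → IsRegularReduction f o s.G (p.val f ord) γ → proj f γ ≠ 0 →
      SingularTopReducible f o s.G γ →
      GenSBStep f o s ⟨s.G, s.H, s.P \ {p}⟩

/-- `(G, H)` is returned by a run of `genSB` (with some choice of ties between pairs of equal
signature and of reducers). -/
def GenSBReturns (f : Fin m → MvPolynomial σ K) (o : ModuleOrder ord m)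
    (G H : Set (FreeMod σ K m)) : Prop :=
  Relation.ReflTransGen (GenSBStep f o) ⟨∅, ∅, Set.range Pair.unit⟩ ⟨G, H, ∅⟩

/-- The elements of `G ∪ H` that have a monomial multiple of signature `T`. -/
def rewriters (o : ModuleOrder ord m) (G H : Set (FreeMod σ K m)) (T : FreeMod σ K m) :
    Set (FreeMod σ K m) :=
  {β | β ∈ G ∪ H ∧ ∃ bβ, IsMonomialMultiple β bβ ∧ o.sig bβ = T}

/-- `r` is a rewrite order on `G ∪ H`: a partial order on `G ∪ H` that is total on `G`. -/
def IsRewriteOrder (r : FreeMod σ K m → FreeMod σ K m → Prop)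
    (G H : Set (FreeMod σ K m)) : Prop :=
  (∀ α ∈ G ∪ H, r α α) ∧
  (∀ α ∈ G ∪ H, ∀ β ∈ G ∪ H, r α β → r β α → α = β) ∧
  (∀ α ∈ G ∪ H, ∀ β ∈ G ∪ H, ∀ γ ∈ G ∪ H, r α β → r β γ → r α γ) ∧
  (∀ α ∈ G, ∀ β ∈ G, r α β ∨ r β α)

/-- `r` is admissible on `G`: if the S-pair of `α, β ∈ G` regular reduces to `γ ∈ G`, then the
generator whose multiple carries the signature of the S-pair is below `γ`. -/
def IsAdmissible (f : Fin m → MvPolynomial σ K) (o : ModuleOrder ord m)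
    (r : FreeMod σ K m → FreeMod σ K m → Prop) (G : Set (FreeMod σ K m)) : Prop :=
  ∀ α ∈ G, ∀ β ∈ G, ∀ γ ∈ G, RegularPair f o α β →
    Relation.ReflTransGen (RegularStep f o G) (sPair f ord α β) γ →
    (o.sigMon (leg f ord β α) < o.sigMon (leg f ord α β) → r α γ) ∧
    (o.sigMon (leg f ord α β) < o.sigMon (leg f ord β α) → r β γ)

/-- `α` is the canonical (that is, `r`-maximal) rewriter in signature `T`. -/
def IsCanonicalRewriter (o : ModuleOrder ord m) (r : FreeMod σ K m → FreeMod σ K m → Prop)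
    (G H : Set (FreeMod σ K m)) (T α : FreeMod σ K m) : Prop :=
  α ∈ rewriters o G H T ∧ ∀ β ∈ rewriters o G H T, r α β → β = α

/-- The rewritability check of `RB`: an S-pair is rewritable if one of the two multiples in it is
rewritable. A unit vector has no generators to be checked. -/
def Pair.Rewritable (f : Fin m → MvPolynomial σ K) (o : ModuleOrder ord m)
    (r : FreeMod σ K m → FreeMod σ K m → Prop) (G H : Set (FreeMod σ K m)) :
    Pair σ K m → Prop
  | .unit _ => False
  | .spair α β =>
      ¬ IsCanonicalRewriter o r G H (o.sig (leg f ord α β)) α ∨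
      ¬ IsCanonicalRewriter o r G H (o.sig (leg f ord β α)) β

/-- One pass through the loop of `RB`, with pairs handled by increasing signature. -/
inductive RBStep (f : Fin m → MvPolynomial σ K) (o : ModuleOrder ord m)
    (r : FreeMod σ K m → FreeMod σ K m → Prop) : State σ K m → State σ K m → Prop
  | rewritten (s : State σ K m) (p : Pair σ K m) :
      IsNext f o s.P p → p.Rewritable f o r s.G s.H →
      RBStep f o r s ⟨s.G, s.H, s.P \ {p}⟩
  | syzygy (s : State σ K m) (p : Pair σ K m) (γ : FreeMod σ K m) :
      IsNext f o s.P p → ¬ p.Rewritable f o r s.G s.H →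
      IsRegularReduction f o s.G (p.val f ord) γ → proj f γ = 0 →
      RBStep f o r s ⟨s.G, s.H ∪ {γ}, s.P \ {p}⟩
  | basis (s : State σ K m) (p : Pair σ K m) (γ : FreeMod σ K m) :
      IsNext f o s.P p → ¬ p.Rewritable f o r s.G s.H →
      IsRegularReduction f o s.G (p.val f ord) γ → proj f γ ≠ 0 →
      RBStep f o r s ⟨s.G ∪ {γ}, s.H, (s.P \ {p}) ∪ newPairs f o s.G γ⟩

/-- The Koszul syzygies `f_i e_j - f_j e_i`, `i < j`. -/
def koszulSyzygies (f : Fin m → MvPolynomial σ K) : Set (FreeMod σ K m) :=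
  {α | ∃ i j, i < j ∧ α = Pi.single j (f i) - Pi.single i (f j)}

/-- `(G, H)` is returned by a run of `RB` with the order `r` in the rewritability check (with some
choice of ties between pairs of equal signature and of reducers). -/
def RBReturns (f : Fin m → MvPolynomial σ K) (o : ModuleOrder ord m)
    (r : FreeMod σ K m → FreeMod σ K m → Prop) (G H : Set (FreeMod σ K m)) : Prop :=
  Relation.ReflTransGen (RBStep f o r) ⟨∅, koszulSyzygies f, Set.range Pair.unit⟩ ⟨G, H, ∅⟩

end Signatures

end SigGB

end

noncomputable section

namespace SigGB

open MvPolynomial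

/-! ### Calculus of signature monomials, and of lead monomials of images. -/

section Basics

variable {σ K : Type*} [Field K] {m : ℕ} {ord : MonomialOrder σ}

/-! ### Signature monomials -/

/-! Only two data of a module element matter for top reduction: its signature monomial and the lead
monomial of its image. The engine is that two elements of the same signature `T`, suitably scaled,
differ by an element of smaller signature (`ModuleOrder.sigMon_sub_lt`), so that knowledge below `T`
carries over to `T`.

Both outputs are signature bases: every non-syzygy is top reducible, regularly or singularly. By
induction on `T` it is enough to find in signature `T` a multiple of a known syzygy, or a multiple
of a basis element that is not regular top reducible (`isSigBasisAt_of_rewriter`). For genSB the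
multiple with least lead monomial serves (`GenSBReturns.exists_rewriter`). For RB the greatest
rewriter serves (`RBReturns.not_red`): if it were reducible, some S-pair would pass the
rewritability test, and admissibility would make its reduction an equal or greater rewriter, which
is impossible.

Let `γ` be in the genSB basis. Some `β` in the RB basis top reduces `γ`, and some `δ` in the genSB
basis top reduces `β`, hence `γ`. As `γ` is neither regular reducible nor singular reducible by an
element of smaller signature, `δ` and `γ` have the same signature, and `β`, lying between them, has
it too. Two fully regular reduced elements of equal signature have the same image up to a scalar
(`eqUpToSigPoly_of_irreducible`). -/

instance (o : ModuleOrder ord m) : WellFoundedLT o.Mon :=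
  ⟨o.isWellOrder.wf⟩

/-- Multiplication of a module monomial (or `⊥`) by `x ^ b`. -/
def ModuleOrder.shift (o : ModuleOrder ord m) (b : σ →₀ ℕ) : WithBot o.Mon → WithBot o.Mon :=
  WithBot.map fun s : o.Mon => o.mon s.1 (b + s.2)

variable (o : ModuleOrder ord m)

lemma ModuleOrder.shift_mon (b : σ →₀ ℕ) (i : Fin m) (a : σ →₀ ℕ) :
    o.shift b (o.mon i a : o.Mon) = (o.mon i (b + a) : o.Mon) := rfl

lemma ModuleOrder.shift_bot (b : σ →₀ ℕ) : o.shift b ⊥ = ⊥ := rfl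

lemma ModuleOrder.shift_strictMono (b : σ →₀ ℕ) : StrictMono (o.shift b) := by
  refine WithBot.strictMono_map_iff.2 ?_
  rintro ⟨i, a⟩ ⟨j, c⟩ h
  exact o.mul_lt b i j a c h

lemma ModuleOrder.shift_add (b c : σ →₀ ℕ) (T : WithBot o.Mon) :
    o.shift (b + c) T = o.shift b (o.shift c T) := by
  cases T with
  | bot => rfl
  | coe s => exact congrArg (fun a => ((o.mon s.1 a : o.Mon) : WithBot o.Mon)) (add_assoc b c s.2)

lemma ModuleOrder.shift_zero (T : WithBot o.Mon) : o.shift 0 T = T := by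
  cases T with
  | bot => rfl
  | coe s => exact congrArg (fun a => ((o.mon s.1 a : o.Mon) : WithBot o.Mon)) (zero_add s.2)

lemma ModuleOrder.lt_shift {b : σ →₀ ℕ} (hb : b ≠ 0) {T : WithBot o.Mon} (hT : T ≠ ⊥) :
    T < o.shift b T := by
  cases T with
  | bot => exact absurd rfl hT
  | coe s =>
    obtain ⟨i, a⟩ := s
    refine WithBot.coe_lt_coe.2 ((o.compatible i a (b + a)).2 ?_)
    rw [map_add]
    exact lt_add_of_pos_left _ (ord.toSyn_lt_iff_ne_zero.2 fun h => hb (ord.toSyn_eq_zero_iff b |>.1 h))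

lemma ModuleOrder.le_shift (b : σ →₀ ℕ) (T : WithBot o.Mon) : T ≤ o.shift b T := by
  by_cases hb : b = 0
  · rw [hb, o.shift_zero]
  by_cases hT : T = ⊥
  · rw [hT]; exact bot_le
  exact (o.lt_shift hb hT).le

lemma ModuleOrder.sigMon_le_iff {α : FreeMod σ K m} {T : WithBot o.Mon} :
    o.sigMon α ≤ T ↔ ∀ i, ∀ a ∈ (α i).support, ((o.mon i a : o.Mon) : WithBot o.Mon) ≤ T := by
  simp [ModuleOrder.sigMon, Finset.sup_le_iff]

lemma ModuleOrder.mon_le_sigMon {α : FreeMod σ K m} {i : Fin m} {a : σ →₀ ℕ}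
    (h : a ∈ (α i).support) : ((o.mon i a : o.Mon) : WithBot o.Mon) ≤ o.sigMon α :=
  o.sigMon_le_iff.1 le_rfl i a h

lemma ModuleOrder.sigMon_eq_mon {α : FreeMod σ K m} (h : o.sigMon α ≠ ⊥) :
    ∃ i, ∃ a ∈ (α i).support, o.sigMon α = (o.mon i a : o.Mon) := by
  by_contra! hc
  have hlt : o.sigMon α < o.sigMon α := by
    conv_lhs => unfold ModuleOrder.sigMon
    have hpos : (⊥ : WithBot o.Mon) < o.sigMon α := bot_lt_iff_ne_bot.2 h
    refine (Finset.sup_lt_iff hpos).2 fun i _ => (Finset.sup_lt_iff hpos).2 fun a ha => ?_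
    exact lt_of_le_of_ne (o.mon_le_sigMon ha) (hc i a ha).symm
  exact lt_irrefl _ hlt

lemma ModuleOrder.sigMon_zero : o.sigMon (0 : FreeMod σ K m) = ⊥ :=
  le_bot_iff.1 (o.sigMon_le_iff.2 fun i a ha => by simp at ha)

lemma ModuleOrder.sigMon_eq_bot {α : FreeMod σ K m} : o.sigMon α = ⊥ ↔ α = 0 := by
  refine ⟨fun h => ?_, fun h => by rw [h, o.sigMon_zero]⟩
  ext i a
  by_contra ha
  have := o.mon_le_sigMon (α := α) (i := i) (a := a) (mem_support_iff.2 (by simpa using ha))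
  rw [h] at this
  exact WithBot.coe_ne_bot (le_bot_iff.1 this)

lemma ModuleOrder.sig_of_eq_mon {α : FreeMod σ K m} {i : Fin m} {a : σ →₀ ℕ}
    (h : o.sigMon α = (o.mon i a : o.Mon)) :
    o.sig α = Pi.single i (monomial a ((α i).coeff a)) := by
  unfold ModuleOrder.sig
  rw [h]
  rfl

lemma ModuleOrder.sigMon_unit (i : Fin m) :
    o.sigMon (Pi.single i 1 : FreeMod σ K m) = (o.mon i 0 : o.Mon) := by
  classical
  refine le_antisymm (o.sigMon_le_iff.2 fun j a ha => ?_) (o.mon_le_sigMon ?_)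
  · by_cases hij : j = i
    · subst hij
      rw [Pi.single_eq_same, mem_support_iff, coeff_one] at ha
      have : a = 0 := by
        by_contra h
        exact ha (if_neg fun h' => h h'.symm)
      rw [this]
    · simp [Pi.single_eq_of_ne hij] at ha
  · simp

lemma ModuleOrder.sigMon_sub_le {α β : FreeMod σ K m} {T : WithBot o.Mon}
    (hα : o.sigMon α ≤ T) (hβ : o.sigMon β ≤ T) : o.sigMon (α - β) ≤ T := by
  classical
  refine o.sigMon_le_iff.2 fun i a ha => ?_
  rcases Finset.mem_union.1 (support_sub σ (α i) (β i) ha) with h | h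
  · exact (o.mon_le_sigMon h).trans hα
  · exact (o.mon_le_sigMon h).trans hβ

lemma ModuleOrder.sigMon_neg (α : FreeMod σ K m) : o.sigMon (-α) = o.sigMon α := by
  unfold ModuleOrder.sigMon
  simp

lemma ModuleOrder.sigMon_sub_of_lt {α β : FreeMod σ K m} (h : o.sigMon β < o.sigMon α) :
    o.sigMon (α - β) = o.sigMon α := by
  refine le_antisymm (o.sigMon_sub_le le_rfl h.le) ?_
  obtain ⟨i, a, ha, hs⟩ := o.sigMon_eq_mon (ne_bot_of_gt h)
  rw [hs]
  refine o.mon_le_sigMon (mem_support_iff.2 ?_)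
  have hb : (β i).coeff a = 0 := by
    by_contra hb
    exact absurd (o.mon_le_sigMon (mem_support_iff.2 hb)) (not_le.2 (hs ▸ h))
  rw [Pi.sub_apply, coeff_sub, hb, sub_zero]
  exact mem_support_iff.1 ha

lemma ModuleOrder.sigMon_smul (b : σ →₀ ℕ) {c : K} (hc : c ≠ 0) (α : FreeMod σ K m) :
    o.sigMon (monomial b c • α) = o.shift b (o.sigMon α) := by
  have hle : o.sigMon (monomial b c • α) ≤ o.shift b (o.sigMon α) := by
    refine o.sigMon_le_iff.2 fun i a ha => ?_
    rw [Pi.smul_apply, smul_eq_mul, mem_support_iff, coeff_monomial_mul'] at ha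
    have hba : b ≤ a := by
      by_contra h
      exact ha (if_neg h)
    rw [if_pos hba] at ha
    have h := (o.shift_strictMono b).monotone
      (o.mon_le_sigMon (mem_support_iff.2 (right_ne_zero_of_mul ha)))
    rwa [o.shift_mon, add_tsub_cancel_of_le hba] at h
  refine le_antisymm hle ?_
  by_cases h0 : o.sigMon α = ⊥
  · rw [h0, o.shift_bot]; exact bot_le
  obtain ⟨i, a, ha, hs⟩ := o.sigMon_eq_mon h0
  rw [hs, o.shift_mon]
  refine o.mon_le_sigMon (mem_support_iff.2 ?_)
  rw [Pi.smul_apply, smul_eq_mul, coeff_monomial_mul]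
  exact mul_ne_zero hc (mem_support_iff.1 ha)

lemma smul_eq_monomial_smul (κ : K) (α : FreeMod σ K m) : κ • α = (monomial 0 κ : MvPolynomial σ K) • α := by
  ext i a
  simp [← C_apply]

lemma ModuleOrder.sigMon_const_smul {κ : K} (hκ : κ ≠ 0) (α : FreeMod σ K m) :
    o.sigMon (κ • α) = o.sigMon α := by
  rw [smul_eq_monomial_smul, o.sigMon_smul 0 hκ, o.shift_zero]

lemma ModuleOrder.sig_const_smul {κ : K} (hκ : κ ≠ 0) (α : FreeMod σ K m) :
    o.sig (κ • α) = κ • o.sig α := by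
  by_cases h0 : o.sigMon α = ⊥
  · rw [o.sigMon_eq_bot.1 h0, smul_zero]
    simp [ModuleOrder.sig, o.sigMon_zero]
  obtain ⟨i, a, ha, hs⟩ := o.sigMon_eq_mon h0
  rw [o.sig_of_eq_mon hs, o.sig_of_eq_mon ((o.sigMon_const_smul hκ α).trans hs), ← Pi.single_smul,
    smul_monomial, Pi.smul_apply, coeff_smul]

lemma ModuleOrder.sigMon_sig (α : FreeMod σ K m) : o.sigMon (o.sig α) = o.sigMon α := by
  by_cases h0 : o.sigMon α = ⊥
  · rw [o.sigMon_eq_bot.1 h0]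
    simp [ModuleOrder.sig, o.sigMon_zero]
  obtain ⟨i, a, ha, hs⟩ := o.sigMon_eq_mon h0
  have : (Pi.single i (monomial a ((α i).coeff a)) : FreeMod σ K m)
      = (monomial a ((α i).coeff a) : MvPolynomial σ K) • Pi.single i 1 := by
    rw [← Pi.single_smul, smul_eq_mul, mul_one]
  rw [o.sig_of_eq_mon hs, this, o.sigMon_smul _ (mem_support_iff.1 ha), o.sigMon_unit, hs]
  exact congrArg (fun a => ((o.mon i a : o.Mon) : WithBot o.Mon)) (add_zero a)

lemma ModuleOrder.exists_sig_eq_smul {α β : FreeMod σ K m} (h : o.sigMon α = o.sigMon β) :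
    ∃ κ : K, κ ≠ 0 ∧ o.sig α = o.sig (κ • β) := by
  by_cases h0 : o.sigMon α = ⊥
  · refine ⟨1, one_ne_zero, ?_⟩
    rw [o.sigMon_eq_bot.1 h0, o.sigMon_eq_bot.1 (h.symm.trans h0), one_smul]
  obtain ⟨i, a, ha, hs⟩ := o.sigMon_eq_mon h0
  obtain ⟨j, b, hb, hs'⟩ := o.sigMon_eq_mon (h ▸ h0)
  have hij : (i, a) = (j, b) := WithBot.coe_injective ((hs.symm.trans h).trans hs')
  obtain ⟨rfl, rfl⟩ := Prod.mk.inj hij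
  have hα := mem_support_iff.1 ha
  have hβ := mem_support_iff.1 hb
  refine ⟨(α i).coeff a / (β i).coeff a, div_ne_zero hα hβ, ?_⟩
  rw [o.sig_const_smul (div_ne_zero hα hβ), o.sig_of_eq_mon hs, o.sig_of_eq_mon hs',
    ← Pi.single_smul, smul_monomial, smul_eq_mul, div_mul_cancel₀ _ hβ]

/-- Disposes of coefficients: from here on regularity and singularity are statements about signature
monomials only. -/
lemma ModuleOrder.scalarEq_sig_iff {α β : FreeMod σ K m} :
    ScalarEq K (o.sig α) (o.sig β) ↔ o.sigMon α = o.sigMon β := by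
  constructor
  · rintro ⟨κ, hκ, h⟩
    rw [← o.sigMon_sig α, h, o.sigMon_const_smul hκ, o.sigMon_sig]
  · intro h
    obtain ⟨κ, hκ, h⟩ := o.exists_sig_eq_smul h
    exact ⟨κ, hκ, h.trans (o.sig_const_smul hκ β)⟩

/-- The signatures agree with their coefficients, so they cancel. Every induction on signatures
below descends through this. -/
lemma ModuleOrder.sigMon_sub_lt {α β : FreeMod σ K m} (h : o.sig α = o.sig β)
    (h0 : o.sigMon α ≠ ⊥) : o.sigMon (α - β) < o.sigMon α := by
  classical
  have hs : o.sigMon α = o.sigMon β := by rw [← o.sigMon_sig α, h, o.sigMon_sig]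
  refine lt_of_le_of_ne (o.sigMon_sub_le le_rfl hs.ge) fun heq => ?_
  obtain ⟨i, a, ha, hd⟩ := o.sigMon_eq_mon (heq ▸ h0)
  rw [o.sig_of_eq_mon (heq ▸ hd), o.sig_of_eq_mon (hs ▸ heq ▸ hd)] at h
  have h1 := congrArg (coeff a) (congrFun h i)
  rw [Pi.single_eq_same, Pi.single_eq_same, coeff_monomial, coeff_monomial, if_pos rfl,
    if_pos rfl] at h1
  exact mem_support_iff.1 ha (by rw [Pi.sub_apply, coeff_sub, h1, sub_self])

/-! ### Images in the polynomial ring -/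

variable (f : Fin m → MvPolynomial σ K)

lemma proj_smul (p : MvPolynomial σ K) (α : FreeMod σ K m) : proj f (p • α) = p * proj f α := by
  simp [proj, Finset.mul_sum, mul_assoc]

lemma proj_sub (α β : FreeMod σ K m) : proj f (α - β) = proj f α - proj f β := by
  simp [proj, sub_mul]

lemma proj_const_smul (κ : K) (α : FreeMod σ K m) : proj f (κ • α) = κ • proj f α := by
  rw [smul_eq_monomial_smul, proj_smul, ← C_apply, smul_eq_C_mul]

lemma proj_zero : proj f (0 : FreeMod σ K m) = 0 := by simp [proj]

lemma sigMon_ne_bot_of_proj_ne_zero {α : FreeMod σ K m} (h : proj f α ≠ 0) : o.sigMon α ≠ ⊥ :=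
  fun h0 => h (by rw [o.sigMon_eq_bot.1 h0, proj_zero])

lemma monomial_ne_zero {b : σ →₀ ℕ} {c : K} (hc : c ≠ 0) : (monomial b c : MvPolynomial σ K) ≠ 0 :=
  fun h => hc (monomial_eq_zero.1 h)

lemma proj_monomial_smul_ne_zero {b : σ →₀ ℕ} {c : K} (hc : c ≠ 0) {α : FreeMod σ K m}
    (h : proj f α ≠ 0) : proj f (monomial b c • α) ≠ 0 := by
  rw [proj_smul]
  exact mul_ne_zero (monomial_ne_zero hc) h

lemma degree_proj_monomial_smul {b : σ →₀ ℕ} {c : K} (hc : c ≠ 0) {α : FreeMod σ K m}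
    (h : proj f α ≠ 0) : ord.degree (proj f (monomial b c • α)) = b + ord.degree (proj f α) := by
  classical
  rw [proj_smul, ord.degree_mul (monomial_ne_zero hc) h, ord.degree_monomial, if_neg hc]

lemma leadingCoeff_proj_monomial_smul (b : σ →₀ ℕ) (c : K) (α : FreeMod σ K m) :
    ord.leadingCoeff (proj f (monomial b c • α)) = c * ord.leadingCoeff (proj f α) := by
  rw [proj_smul, ord.leadingCoeff_mul, ord.leadingCoeff_monomial]

lemma degree_proj_const_smul {κ : K} (hκ : κ ≠ 0) (α : FreeMod σ K m) :
    ord.degree (proj f (κ • α)) = ord.degree (proj f α) := by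
  by_cases h : proj f α = 0
  · rw [proj_const_smul, h, smul_zero]
  · rw [smul_eq_monomial_smul, degree_proj_monomial_smul f hκ h, zero_add]

end Basics

/-! ### Reduction steps and S-pairs in terms of lead and signature monomials. -/

section Reduction

variable {σ K : Type*} [Field K] {m : ℕ} {ord : MonomialOrder σ}
  (f : Fin m → MvPolynomial σ K) (o : ModuleOrder ord m)

/-! ### Regular reduction -/

/-- The monomial `x ^ d` is the lead monomial of a multiple of an element of `G` with signature
below `T`. -/
def Red (G : Set (FreeMod σ K m)) (d : σ →₀ ℕ) (T : WithBot o.Mon) : Prop :=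
  ∃ β ∈ G, ∃ b, b + ord.degree (proj f β) = d ∧ o.shift b (o.sigMon β) < T

variable {f o}

lemma exists_regularStep {G : Set (FreeMod σ K m)} {α : FreeMod σ K m}
    (hG : ∀ β ∈ G, proj f β ≠ 0) {d : σ →₀ ℕ} (hd : d ∈ (proj f α).support)
    (h : Red f o G d (o.sigMon α)) : ∃ δ, RegularStep f o G α δ := by
  obtain ⟨β, hβ, b, hbd, hs⟩ := h
  have hlc := ord.leadingCoeff_ne_zero_iff.2 (hG β hβ)
  -- The scalar that makes the lead term of the multiple equal to the term of `proj f α` at `d`.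
  have hc : (proj f α).coeff d / ord.leadingCoeff (proj f β) ≠ 0 :=
    div_ne_zero (mem_support_iff.1 hd) hlc
  refine ⟨_, β, hβ, _, ⟨b, _, hc, rfl⟩, ⟨_, ⟨d, hd, rfl⟩, proj_monomial_smul_ne_zero f hc (hG β hβ),
    ?_, ?_⟩, ?_, rfl⟩
  · rw [MonomialOrder.leadingTerm, degree_proj_monomial_smul f hc (hG β hβ),
      leadingCoeff_proj_monomial_smul, hbd, div_mul_cancel₀ _ hlc]
  · rw [o.sigMon_smul b hc]
    exact hs.le
  · rw [o.scalarEq_sig_iff, o.sigMon_smul b hc]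
    exact hs.ne

lemma RegularStep.sigMon_eq {G : Set (FreeMod σ K m)} {α α' : FreeMod σ K m}
    (h : RegularStep f o G α α') : o.sigMon α' = o.sigMon α := by
  obtain ⟨β, -, bβ, -, ⟨t, -, -, -, hle⟩, hne, rfl⟩ := h
  exact o.sigMon_sub_of_lt (lt_of_le_of_ne hle fun heq => hne (o.scalarEq_sig_iff.2 heq))

/-- The reducer's lead term is a term of the image of `α`, so subtracting it cannot raise the lead
monomial. A zero image has no term to reduce, which lets nonvanishing travel backwards along a chain
of reductions. -/
lemma RegularStep.degree_le {G : Set (FreeMod σ K m)} {α α' : FreeMod σ K m}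
    (h : RegularStep f o G α α') :
    ord.toSyn (ord.degree (proj f α')) ≤ ord.toSyn (ord.degree (proj f α)) ∧ proj f α ≠ 0 := by
  obtain ⟨β, -, bβ, -, ⟨t, ⟨d, hd, rfl⟩, -, ht, -⟩, -, rfl⟩ := h
  constructor
  · rw [proj_sub]
    refine ord.degree_sub_le.trans (sup_le le_rfl ?_)
    have hdeg : ord.degree (proj f bβ) = d := by
      classical
      rw [← ord.degree_leadingTerm, ht, ord.degree_monomial, if_neg (mem_support_iff.1 hd)]
    rw [hdeg]
    exact ord.le_degree hd
  · rintro h0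
    rw [h0] at hd
    simp at hd

lemma RegularStep.mono {G G' : Set (FreeMod σ K m)} (hG : G ⊆ G') {α α' : FreeMod σ K m}
    (h : RegularStep f o G α α') : RegularStep f o G' α α' := by
  obtain ⟨β, hβ, h⟩ := h
  exact ⟨β, hG hβ, h⟩

lemma sigMon_eq_of_reduces {G : Set (FreeMod σ K m)} {α γ : FreeMod σ K m}
    (h : Relation.ReflTransGen (RegularStep f o G) α γ) : o.sigMon γ = o.sigMon α := by
  induction h with
  | refl => rfl
  | tail _ h ih => rw [h.sigMon_eq, ih]

lemma degree_le_of_reduces {G : Set (FreeMod σ K m)} {α γ : FreeMod σ K m}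
    (h : Relation.ReflTransGen (RegularStep f o G) α γ) (hγ : proj f γ ≠ 0) :
    proj f α ≠ 0 ∧ ord.toSyn (ord.degree (proj f γ)) ≤ ord.toSyn (ord.degree (proj f α)) := by
  induction h using Relation.ReflTransGen.head_induction_on with
  | refl => exact ⟨hγ, le_rfl⟩
  | head h _ ih => exact ⟨h.degree_le.2, ih.2.trans h.degree_le.1⟩

/-! ### Singular top reduction -/

/-- The lead monomial and the signature of `γ` are those of a multiple of `β`. -/
def SingularDivides (f : Fin m → MvPolynomial σ K) (o : ModuleOrder ord m)
    (β γ : FreeMod σ K m) : Prop :=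
  ∃ b, b + ord.degree (proj f β) = ord.degree (proj f γ) ∧ o.shift b (o.sigMon β) = o.sigMon γ

/-- The scalar of the multiple is free and can be chosen to match lead terms exactly, so only
monomials count. -/
lemma singularTopReducible_iff {G : Set (FreeMod σ K m)} (hG : ∀ β ∈ G, proj f β ≠ 0)
    {γ : FreeMod σ K m} (hγ : proj f γ ≠ 0) :
    SingularTopReducible f o G γ ↔ ∃ β ∈ G, SingularDivides f o β γ := by
  constructor
  · rintro ⟨β, hβ, bβ, ⟨b, c, hc, rfl⟩, -, ⟨κ, hκ, hlt⟩, hs⟩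
    refine ⟨β, hβ, b, ?_, ?_⟩
    · rw [← degree_proj_monomial_smul f hc (hG β hβ), ← ord.degree_leadingTerm, hlt,
        smul_eq_C_mul, ord.degree_mul (by simpa using hκ)
          (fun h => hγ ((ord.leadingTerm_eq_zero_iff _).1 h)), ord.degree_C, zero_add,
        ord.degree_leadingTerm]
    · rw [← o.sigMon_smul b hc, o.scalarEq_sig_iff.1 hs]
  · rintro ⟨β, hβ, b, hd, hs⟩
    have hlc := ord.leadingCoeff_ne_zero_iff.2 (hG β hβ)
    have hc : ord.leadingCoeff (proj f γ) / ord.leadingCoeff (proj f β) ≠ 0 :=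
      div_ne_zero (ord.leadingCoeff_ne_zero_iff.2 hγ) hlc
    have hlt : ord.leadingTerm (proj f (monomial b
        (ord.leadingCoeff (proj f γ) / ord.leadingCoeff (proj f β)) • β)) =
        ord.leadingTerm (proj f γ) := by
      rw [MonomialOrder.leadingTerm, degree_proj_monomial_smul f hc (hG β hβ),
        leadingCoeff_proj_monomial_smul, hd, div_mul_cancel₀ _ hlc, MonomialOrder.leadingTerm]
    have hs' := (o.sigMon_smul b hc β).trans hs
    exact ⟨β, hβ, _, ⟨b, _, hc, rfl⟩,
      ⟨_, ⟨_, ord.degree_mem_support hγ, rfl⟩, proj_monomial_smul_ne_zero f hc (hG β hβ), hlt,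
        hs'.le⟩, ⟨1, one_ne_zero, by rw [one_smul, hlt]⟩, o.scalarEq_sig_iff.2 hs'⟩

/-! ### S-pairs -/

lemma cofactor_coeff_ne_zero {α : FreeMod σ K m} (hα : proj f α ≠ 0) :
    (ord.leadingCoeff (proj f α))⁻¹ ≠ 0 :=
  inv_ne_zero (ord.leadingCoeff_ne_zero_iff.2 hα)

lemma isMonomialMultiple_leg {α : FreeMod σ K m} (hα : proj f α ≠ 0) (β : FreeMod σ K m) :
    IsMonomialMultiple α (leg f ord α β) :=
  ⟨_, _, cofactor_coeff_ne_zero hα, rfl⟩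

lemma sigMon_leg {α : FreeMod σ K m} (hα : proj f α ≠ 0) (β : FreeMod σ K m) :
    o.sigMon (leg f ord α β) = o.shift (ord.degree (proj f α) ⊔ ord.degree (proj f β) -
      ord.degree (proj f α)) (o.sigMon α) :=
  o.sigMon_smul _ (cofactor_coeff_ne_zero hα) α

lemma sPair_swap (α β : FreeMod σ K m) : sPair f ord β α = -sPair f ord α β := by
  simp [sPair]

lemma RegularPair.symm {α β : FreeMod σ K m} (h : RegularPair f o α β) :
    RegularPair f o β α := by
  unfold RegularPair at *
  rw [o.scalarEq_sig_iff] at *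
  exact fun h' => h h'.symm

lemma regularPair_self (α : FreeMod σ K m) : ¬ RegularPair f o α α :=
  fun h => h (o.scalarEq_sig_iff.2 rfl)

lemma sigMon_sPair {α β : FreeMod σ K m} (h : RegularPair f o α β) :
    o.sigMon (sPair f ord α β) = o.sigMon (leg f ord α β) ⊔ o.sigMon (leg f ord β α) := by
  rcases lt_or_gt_of_ne (fun heq => h (o.scalarEq_sig_iff.2 heq)) with hlt | hlt
  · rw [← o.sigMon_neg, ← sPair_swap, sup_eq_right.2 hlt.le, sPair, o.sigMon_sub_of_lt hlt]
  · rw [sup_eq_left.2 hlt.le, sPair, o.sigMon_sub_of_lt hlt]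

/-- The lead terms cancel. A nonzero difference is required because the zero polynomial has degree
`0`, which is not below `d = 0`. -/
lemma degree_sub_lt_of_eq {p q : MvPolynomial σ K} {d : σ →₀ ℕ} (hp : ord.degree p = d)
    (hq : ord.degree q = d) (hc : ord.leadingCoeff p = ord.leadingCoeff q) (h : p - q ≠ 0) :
    ord.toSyn (ord.degree (p - q)) < ord.toSyn d := by
  have hle : ord.toSyn (ord.degree (p - q)) ≤ ord.toSyn d := by
    have := ord.degree_sub_le (f := p) (g := q)
    rwa [hp, hq, max_self] at this
  refine lt_of_le_of_ne hle fun heq => ?_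
  have hd := ord.degree_mem_support h
  rw [ord.toSyn.injective heq, mem_support_iff, coeff_sub] at hd
  refine hd ?_
  rw [MonomialOrder.leadingCoeff, MonomialOrder.leadingCoeff, hp, hq] at hc
  rw [hc, sub_self]

lemma degree_leg {α : FreeMod σ K m} (hα : proj f α ≠ 0) (β : FreeMod σ K m) :
    ord.degree (proj f (leg f ord α β)) = ord.degree (proj f α) ⊔ ord.degree (proj f β) := by
  rw [leg, cofactor, degree_proj_monomial_smul f (cofactor_coeff_ne_zero hα) hα,
    tsub_add_cancel_of_le le_sup_left]

lemma leadingCoeff_leg {α : FreeMod σ K m} (hα : proj f α ≠ 0) (β : FreeMod σ K m) :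
    ord.leadingCoeff (proj f (leg f ord α β)) = 1 := by
  rw [leg, cofactor, leadingCoeff_proj_monomial_smul,
    inv_mul_cancel₀ (ord.leadingCoeff_ne_zero_iff.2 hα)]

lemma degree_sPair_lt {α β : FreeMod σ K m} (hα : proj f α ≠ 0) (hβ : proj f β ≠ 0)
    (h : proj f (sPair f ord α β) ≠ 0) :
    ord.toSyn (ord.degree (proj f (sPair f ord α β))) <
      ord.toSyn (ord.degree (proj f α) ⊔ ord.degree (proj f β)) := by
  rw [sPair, proj_sub] at *
  exact degree_sub_lt_of_eq (degree_leg hα β) ((degree_leg hβ α).trans (sup_comm _ _))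
    ((leadingCoeff_leg hα β).trans (leadingCoeff_leg hβ α).symm) h

/-- If multiples of `α` and `β` have the same lead monomial and the signature of the first is
larger, then both are multiples by a common `x` of the legs of the S-pair of `α` and `β`. -/
lemma exists_regularPair {α β : FreeMod σ K m} (hα : proj f α ≠ 0) (hβ : proj f β ≠ 0)
    {b c d : σ →₀ ℕ} (hb : b + ord.degree (proj f α) = d) (hc : c + ord.degree (proj f β) = d)
    (hlt : o.shift c (o.sigMon β) < o.shift b (o.sigMon α)) :
    ∃ x, o.shift x (o.sigMon (leg f ord α β)) = o.shift b (o.sigMon α) ∧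
      o.shift x (o.sigMon (leg f ord β α)) = o.shift c (o.sigMon β) ∧
      x + (ord.degree (proj f α) ⊔ ord.degree (proj f β)) = d ∧
      o.sigMon (leg f ord β α) < o.sigMon (leg f ord α β) ∧ RegularPair f o α β := by
  -- Both lead monomials divide `x ^ d`, hence so does their lcm; the common factor is the quotient
  -- `d - l`.
  have hle : ord.degree (proj f α) ⊔ ord.degree (proj f β) ≤ d :=
    sup_le (hb ▸ le_add_self) (hc ▸ le_add_self)
  have hx := tsub_add_cancel_of_le hle
  set l := ord.degree (proj f α) ⊔ ord.degree (proj f β) with hl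
  have h1 : o.shift (d - l) (o.sigMon (leg f ord α β)) = o.shift b (o.sigMon α) := by
    rw [sigMon_leg hα, ← hl, ← o.shift_add]
    congr 1
    refine add_right_cancel (b := ord.degree (proj f α)) ?_
    rw [add_assoc, tsub_add_cancel_of_le le_sup_left, hx, hb]
  have h2 : o.shift (d - l) (o.sigMon (leg f ord β α)) = o.shift c (o.sigMon β) := by
    rw [sigMon_leg hβ, sup_comm, ← hl, ← o.shift_add]
    congr 1
    refine add_right_cancel (b := ord.degree (proj f β)) ?_
    rw [add_assoc, tsub_add_cancel_of_le le_sup_right, hx, hc]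
  have h3 : o.sigMon (leg f ord β α) < o.sigMon (leg f ord α β) := by
    rw [← h1, ← h2] at hlt
    exact (o.shift_strictMono _).lt_iff_lt.1 hlt
  exact ⟨d - l, h1, h2, hx, h3, fun h => h3.ne' (o.scalarEq_sig_iff.1 h)⟩

/-- The entry `p` of a pair set is the S-pair of `α` and `β`, in either order. -/
def IsPairOf (p : Pair σ K m) (α β : FreeMod σ K m) : Prop :=
  p = .spair α β ∨ p = .spair β α

lemma IsPairOf.sigMon_val {p : Pair σ K m} {α β : FreeMod σ K m} (hp : IsPairOf p α β)
    (h : RegularPair f o α β) (hlt : o.sigMon (leg f ord β α) < o.sigMon (leg f ord α β)) :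
    o.sigMon (p.val f ord) = o.sigMon (leg f ord α β) := by
  rcases hp with rfl | rfl
  · exact (sigMon_sPair h).trans (sup_eq_left.2 hlt.le)
  · exact (sigMon_sPair h.symm).trans (sup_eq_right.2 hlt.le)

lemma IsPairOf.degree_val_lt {p : Pair σ K m} {α β : FreeMod σ K m} (hp : IsPairOf p α β)
    (hα : proj f α ≠ 0) (hβ : proj f β ≠ 0) (h : proj f (p.val f ord) ≠ 0) :
    ord.toSyn (ord.degree (proj f (p.val f ord))) <
      ord.toSyn (ord.degree (proj f α) ⊔ ord.degree (proj f β)) := by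
  rcases hp with rfl | rfl
  · exact degree_sPair_lt hα hβ h
  · rw [sup_comm]
    exact degree_sPair_lt hβ hα h

/-- Forming the S-pair cancels the lcm, and regular reduction keeps the signature without raising
the lead monomial. The strict drop gives the contradiction in both correctness proofs. -/
lemma IsPairOf.reduces {p : Pair σ K m} {α β : FreeMod σ K m} (hp : IsPairOf p α β)
    (hα : proj f α ≠ 0) (hβ : proj f β ≠ 0) (h : RegularPair f o α β)
    (hlt : o.sigMon (leg f ord β α) < o.sigMon (leg f ord α β))
    {G : Set (FreeMod σ K m)} {γ : FreeMod σ K m}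
    (hγ : Relation.ReflTransGen (RegularStep f o G) (p.val f ord) γ) :
    o.sigMon γ = o.sigMon (leg f ord α β) ∧ (proj f γ ≠ 0 →
      ord.toSyn (ord.degree (proj f γ)) <
        ord.toSyn (ord.degree (proj f α) ⊔ ord.degree (proj f β))) := by
  refine ⟨(sigMon_eq_of_reduces hγ).trans (hp.sigMon_val h hlt), fun h0 => ?_⟩
  obtain ⟨h1, h2⟩ := degree_le_of_reduces hγ h0
  exact h2.trans_lt (hp.degree_val_lt hα hβ h1)

end Reduction

/-! ### Both algorithms compute signature bases, and regular reduced elements are unique. -/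

section SignatureBasis

variable {σ K : Type*} [Field K] {m : ℕ} {ord : MonomialOrder σ}
  (f : Fin m → MvPolynomial σ K) (o : ModuleOrder ord m)

/-! ### Signature bases -/

/-- Every module element of signature `T` that is not a syzygy is top reducible modulo `G`,
regularly or singularly. -/
def IsSigBasisAt (G : Set (FreeMod σ K m)) (T : WithBot o.Mon) : Prop :=
  ∀ α, o.sigMon α = T → proj f α ≠ 0 →
    ∃ β ∈ G, ∃ b, b + ord.degree (proj f β) = ord.degree (proj f α) ∧ o.shift b (o.sigMon β) ≤ T

/-- The signature `T` is divisible by the signature of an element of `H`. -/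
def SigDivisible (H : Set (FreeMod σ K m)) (T : WithBot o.Mon) : Prop :=
  ∃ h ∈ H, ∃ b, o.shift b (o.sigMon h) = T

variable {f o}

lemma red_of_sigMon_lt {G : Set (FreeMod σ K m)} {T : WithBot o.Mon}
    (hT : ∀ S < T, IsSigBasisAt f o G S) {α : FreeMod σ K m} (hα : o.sigMon α < T)
    (h0 : proj f α ≠ 0) : Red f o G (ord.degree (proj f α)) T := by
  obtain ⟨β, hβ, b, hd, hs⟩ := hT _ hα α rfl h0
  exact ⟨β, hβ, b, hd, hs.trans_lt hα⟩

/-- Subtracting a multiple of the syzygy lowers the signature and leaves the image unchanged. -/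
lemma red_of_sigDivisible {G H : Set (FreeMod σ K m)} {T : WithBot o.Mon}
    (hT : ∀ S < T, IsSigBasisAt f o G S) (hsyz : ∀ h ∈ H, proj f h = 0)
    (hH : SigDivisible o H T) {α : FreeMod σ K m} (hα : o.sigMon α = T) (h0 : proj f α ≠ 0) :
    Red f o G (ord.degree (proj f α)) T := by
  obtain ⟨h, hh, b, hb⟩ := hH
  have hs : o.sigMon α = o.sigMon ((monomial b 1 : MvPolynomial σ K) • h) := by
    rw [o.sigMon_smul b one_ne_zero, hb, hα]
  obtain ⟨κ, -, hsig⟩ := o.exists_sig_eq_smul hs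
  have hlt := o.sigMon_sub_lt hsig (sigMon_ne_bot_of_proj_ne_zero o f h0)
  have hp : proj f (α - κ • (monomial b 1 : MvPolynomial σ K) • h) = proj f α := by
    rw [proj_sub, proj_const_smul, proj_smul, hsyz h hh, mul_zero, smul_zero, sub_zero]
  rw [← hp]
  exact red_of_sigMon_lt hT (hα ▸ hlt) (hp ▸ h0)

/-- If the lead monomials differ, the larger one leads `α - κ • β`, whose signature is below `T`,
and is therefore reducible. By `hred` it cannot be that of `β`. -/
lemma red_or_degree_eq {G : Set (FreeMod σ K m)} {T : WithBot o.Mon}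
    (hT : ∀ S < T, IsSigBasisAt f o G S) {α β : FreeMod σ K m} (hα : o.sigMon α = T)
    (hβ : o.sigMon β = T) (hα0 : proj f α ≠ 0)
    (hred : ¬ Red f o G (ord.degree (proj f β)) T) :
    Red f o G (ord.degree (proj f α)) T ∨ ord.degree (proj f α) = ord.degree (proj f β) := by
  obtain ⟨κ, hκ, hsig⟩ := o.exists_sig_eq_smul (hα.trans hβ.symm)
  have hlt := o.sigMon_sub_lt hsig (sigMon_ne_bot_of_proj_ne_zero o f hα0)
  rw [hα] at hlt
  have hκd := degree_proj_const_smul (ord := ord) f hκ β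
  by_contra! hc
  obtain ⟨hαred, hne⟩ := hc
  have hne' : ord.toSyn (ord.degree (proj f α)) ≠ ord.toSyn (ord.degree (proj f (κ • β))) :=
    fun h => hne ((ord.toSyn.injective h).trans hκd)
  have h0 : proj f (α - κ • β) ≠ 0 := by
    rw [proj_sub]
    intro h
    exact hne' (by rw [sub_eq_zero.1 h])
  have h := red_of_sigMon_lt hT hlt h0
  rcases lt_or_gt_of_ne hne' with hlt' | hlt'
  · rw [proj_sub, ← neg_sub, ord.degree_neg, ord.degree_sub_of_lt hlt', hκd] at h
    exact hred h
  · rw [proj_sub, ord.degree_sub_of_lt hlt'] at h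
    exact hαred h

/-- The induction step shared by both algorithms: one irreducible multiple in signature `T` controls
all elements of that signature. -/
lemma isSigBasisAt_of_rewriter {G H : Set (FreeMod σ K m)} {T : WithBot o.Mon}
    (hT : ∀ S < T, IsSigBasisAt f o G S) (hnz : ∀ β ∈ G, proj f β ≠ 0)
    (hsyz : ∀ h ∈ H, proj f h = 0)
    (h : SigDivisible o H T ∨ ∃ β ∈ G, ∃ b, o.shift b (o.sigMon β) = T ∧
      ¬ Red f o G (b + ord.degree (proj f β)) T) : IsSigBasisAt f o G T := by
  intro α hα h0
  have key : Red f o G (ord.degree (proj f α)) T ∨ ∃ β ∈ G, ∃ b,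
      b + ord.degree (proj f β) = ord.degree (proj f α) ∧ o.shift b (o.sigMon β) = T := by
    rcases h with hH | ⟨β, hβ, b, hb, hred⟩
    · exact .inl (red_of_sigDivisible hT hsyz hH hα h0)
    · have hdeg := degree_proj_monomial_smul (ord := ord) (b := b) f (one_ne_zero (α := K))
        (hnz β hβ)
      rw [← hdeg] at hred
      refine (red_or_degree_eq hT hα ((o.sigMon_smul b one_ne_zero β).trans hb) h0 hred).imp_right fun heq => ?_
      exact ⟨β, hβ, b, hdeg.symm.trans heq.symm, hb⟩
  rcases key with ⟨β, hβ, b, hd, hs⟩ | ⟨β, hβ, b, hd, hs⟩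
  · exact ⟨β, hβ, b, hd, hs.le⟩
  · exact ⟨β, hβ, b, hd, hs.le⟩

/-! ### Invariants of the algorithms -/

variable (f o)

/-- Properties of the program variables that persist during the algorithms. Here `D G H p` says
that the entry `p` of the pair set has been dealt with. -/
structure Invariant (D : Set (FreeMod σ K m) → Set (FreeMod σ K m) → Pair σ K m → Prop)
    (s : State σ K m) : Prop where
  finite : s.G.Finite
  proj_ne_zero : ∀ β ∈ s.G, proj f β ≠ 0
  proj_eq_zero : ∀ h ∈ s.H, proj f h = 0
  irreducible : ∀ β ∈ s.G, ∀ d ∈ (proj f β).support, ¬ Red f o s.G d (o.sigMon β)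
  sigMon_le : ∀ β ∈ s.G, ∀ p ∈ s.P, o.sigMon β ≤ o.sigMon (p.val f ord)
  generators : ∀ α β, Pair.spair α β ∈ s.P → α ∈ s.G ∧ β ∈ s.G
  unit_mem : ∀ i, Pair.unit i ∈ s.P ∨ D s.G s.H (.unit i)
  pair_mem : ∀ α ∈ s.G, ∀ β ∈ s.G, RegularPair f o α β →
    ∃ p, IsPairOf p α β ∧ (p ∈ s.P ∨ D s.G s.H p)

variable {f o} {D : Set (FreeMod σ K m) → Set (FreeMod σ K m) → Pair σ K m → Prop}

/-- The property `D G H p` is preserved when `G` and `H` grow. -/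
def IsPersistent
    (D : Set (FreeMod σ K m) → Set (FreeMod σ K m) → Pair σ K m → Prop) : Prop :=
  ∀ G H G' H' p, G ⊆ G' → H ⊆ H' → D G H p → D G' H' p

lemma Invariant.start {H : Set (FreeMod σ K m)} (hH : ∀ h ∈ H, proj f h = 0) :
    Invariant f o D ⟨∅, H, Set.range Pair.unit⟩ where
  finite := Set.finite_empty
  proj_ne_zero := fun _ h => h.elim
  proj_eq_zero := hH
  irreducible := fun _ h => h.elim
  sigMon_le := fun _ h => h.elim
  generators := by rintro α β ⟨i, hi⟩; cases hi
  unit_mem := fun i => .inl ⟨i, rfl⟩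
  pair_mem := fun _ h => h.elim

lemma Invariant.discard (hD : IsPersistent D)
    {s : State σ K m} (hs : Invariant f o D s) {p : Pair σ K m} {H : Set (FreeMod σ K m)}
    (hH : s.H ⊆ H) (hsyz : ∀ h ∈ H, proj f h = 0) (hp : D s.G H p) :
    Invariant f o D ⟨s.G, H, s.P \ {p}⟩ := by
  have hmem : ∀ q, q ∈ s.P ∨ D s.G s.H q → q ∈ s.P \ {p} ∨ D s.G H q := by
    rintro q (hq | hq)
    · by_cases hqp : q = p
      · exact .inr (hqp ▸ hp)
      · exact .inl ⟨hq, hqp⟩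
    · exact .inr (hD _ _ _ _ _ subset_rfl hH hq)
  exact {
    finite := hs.finite
    proj_ne_zero := hs.proj_ne_zero
    proj_eq_zero := hsyz
    irreducible := hs.irreducible
    sigMon_le := fun β hβ q hq => hs.sigMon_le β hβ q hq.1
    generators := fun α β hq => hs.generators α β hq.1
    unit_mem := fun i => hmem _ (hs.unit_mem i)
    pair_mem := fun α hα β hβ h => (hs.pair_mem α hα β hβ h).imp fun q hq => ⟨hq.1, hmem q hq.2⟩ }

lemma sigMon_le_of_mem_newPairs {G : Set (FreeMod σ K m)} {γ : FreeMod σ K m} (hγ : proj f γ ≠ 0) {p : Pair σ K m} (hp : p ∈ newPairs f o G γ) :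
    o.sigMon γ ≤ o.sigMon (p.val f ord) := by
  obtain ⟨α, hα, hreg, rfl⟩ := hp
  refine le_trans ?_ (le_sup_right.trans (sigMon_sPair hreg).ge)
  rw [sigMon_leg hγ]
  exact o.le_shift _ _

lemma Invariant.sigMon_le_reduced {s : State σ K m} (hs : Invariant f o D s) {p : Pair σ K m}
    (hp : IsNext f o s.P p) {γ : FreeMod σ K m}
    (hγ : IsRegularReduction f o s.G (p.val f ord) γ) {β : FreeMod σ K m} (hβ : β ∈ s.G) :
    o.sigMon β ≤ o.sigMon γ :=
  (hs.sigMon_le β hβ p hp.1).trans (sigMon_eq_of_reduces hγ.1).ge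

lemma Invariant.insert (hD : IsPersistent D)
    {s : State σ K m} (hs : Invariant f o D s) {p : Pair σ K m} (hp : IsNext f o s.P p)
    {γ : FreeMod σ K m} (hγ : IsRegularReduction f o s.G (p.val f ord) γ) (h0 : proj f γ ≠ 0)
    (hpD : D (s.G ∪ {γ}) s.H p) :
    Invariant f o D ⟨s.G ∪ {γ}, s.H, (s.P \ {p}) ∪ newPairs f o s.G γ⟩ := by
  have hle : ∀ β ∈ s.G ∪ {γ}, o.sigMon β ≤ o.sigMon γ := by
    rintro β (hβ | rfl)
    · exact hs.sigMon_le_reduced hp hγ hβ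
    · exact le_rfl
  have hsub : s.G ⊆ s.G ∪ {γ} := Set.subset_union_left
  have hmem : ∀ q, q ∈ s.P ∨ D s.G s.H q →
      q ∈ (s.P \ {p}) ∪ newPairs f o s.G γ ∨ D (s.G ∪ {γ}) s.H q := by
    rintro q (hq | hq)
    · by_cases hqp : q = p
      · exact .inr (hqp ▸ hpD)
      · exact .inl (.inl ⟨hq, hqp⟩)
    · exact .inr (hD _ _ _ _ _ hsub subset_rfl hq)
  -- No element of the new basis has larger signature than `γ`, so a multiple of `γ` never has the
  -- strictly smaller signature that a regular reducer needs.
  have hold : ∀ β ∈ s.G ∪ {γ}, ∀ d, Red f o (s.G ∪ {γ}) d (o.sigMon β) →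
      Red f o s.G d (o.sigMon β) := by
    rintro β hβ d ⟨δ, hδ | rfl, b, hd, hlt⟩
    · exact ⟨δ, hδ, b, hd, hlt⟩
    · exact absurd ((hle β hβ).trans (o.le_shift b _)) (not_le.2 hlt)
  exact {
    finite := hs.finite.union (Set.finite_singleton γ)
    proj_ne_zero := by
      rintro β (hβ | rfl)
      · exact hs.proj_ne_zero β hβ
      · exact h0
    proj_eq_zero := hs.proj_eq_zero
    irreducible := by
      rintro β hβ d hd hred
      have h := hold β hβ d hred
      rcases hβ with hβ | rfl
      · exact hs.irreducible β hβ d hd h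
      · obtain ⟨δ, hδ⟩ := exists_regularStep hs.proj_ne_zero hd h
        exact hγ.2 δ hδ
    sigMon_le := by
      rintro β hβ q (hq | hq)
      · exact (hle β hβ).trans ((sigMon_eq_of_reduces hγ.1).le.trans (hp.2 q hq.1))
      · exact (hle β hβ).trans (sigMon_le_of_mem_newPairs h0 hq)
    generators := by
      rintro α β (hq | ⟨δ, hδ, -, hq⟩)
      · exact ⟨hsub (hs.generators α β hq.1).1, hsub (hs.generators α β hq.1).2⟩
      · cases hq
        exact ⟨hsub hδ, .inr rfl⟩
    unit_mem := fun i => hmem _ (hs.unit_mem i)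
    pair_mem := by
      rintro α (hα | rfl) β (hβ | rfl) hreg
      · exact (hs.pair_mem α hα β hβ hreg).imp fun q hq => ⟨hq.1, hmem q hq.2⟩
      · exact ⟨_, .inl rfl, .inl (.inr ⟨α, hα, hreg, rfl⟩)⟩
      · exact ⟨_, .inr rfl, .inl (.inr ⟨β, hβ, hreg.symm, rfl⟩)⟩
      · exact absurd hreg (regularPair_self _) }

/-- A signature reached by multiplication from that of the unit vectors. -/
lemma exists_shift_of_unit {T : WithBot o.Mon} (hT : T ≠ ⊥) :
    ∃ i a, o.shift a (o.sigMon (Pair.val f ord (.unit i : Pair σ K m))) = T := by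
  obtain ⟨⟨i, a⟩, rfl⟩ := WithBot.ne_bot_iff_exists.1 hT
  refine ⟨i, a, ?_⟩
  rw [Pair.val, o.sigMon_unit, o.shift_mon]
  exact congrArg (fun a => ((o.mon i a : o.Mon) : WithBot o.Mon)) (add_zero a)

/-! ### Correctness of `genSB` -/

/-- The entry `p` of the pair set of `genSB` has been dealt with. -/
def GenSBDone (f : Fin m → MvPolynomial σ K) (o : ModuleOrder ord m)
    (G H : Set (FreeMod σ K m)) (p : Pair σ K m) : Prop :=
  ∃ γ, Relation.ReflTransGen (RegularStep f o G) (p.val f ord) γ ∧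
    (γ ∈ H ∨ proj f γ ≠ 0 ∧ ∃ δ ∈ G, SingularDivides f o δ γ)

lemma reduces_mono {G G' : Set (FreeMod σ K m)} (hG : G ⊆ G') {α γ : FreeMod σ K m}
    (h : Relation.ReflTransGen (RegularStep f o G) α γ) :
    Relation.ReflTransGen (RegularStep f o G') α γ :=
  Relation.ReflTransGen.mono (fun _ _ => RegularStep.mono hG) _ _ h

lemma isPersistent_genSBDone : IsPersistent (GenSBDone f o (m := m)) := by
  rintro G H G' H' p hG hH ⟨γ, hγ, h⟩
  refine ⟨γ, reduces_mono hG hγ, ?_⟩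
  rcases h with h | ⟨h0, δ, hδ, h⟩
  · exact .inl (hH h)
  · exact .inr ⟨h0, δ, hG hδ, h⟩

lemma singularDivides_self (γ : FreeMod σ K m) : SingularDivides f o γ γ :=
  ⟨0, zero_add _, o.shift_zero _⟩

/-- No element of `G` is singular top reducible modulo those of smaller signature. -/
def IsSingularReduced (f : Fin m → MvPolynomial σ K) (o : ModuleOrder ord m)
    (G : Set (FreeMod σ K m)) : Prop :=
  ∀ γ ∈ G, ∀ δ ∈ G, o.sigMon δ < o.sigMon γ → ¬ SingularDivides f o δ γ

lemma GenSBStep.invariant {s s' : State σ K m} (h : GenSBStep f o s s')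
    (hs : Invariant f o (GenSBDone f o) s) (hsing : IsSingularReduced f o s.G) :
    Invariant f o (GenSBDone f o) s' ∧ IsSingularReduced f o s'.G := by
  cases h with
  | syzygy p γ hp hγ h0 =>
    refine ⟨hs.discard isPersistent_genSBDone Set.subset_union_left ?_ ⟨γ, hγ.1, .inl (.inr rfl)⟩, hsing⟩
    rintro h (hh | rfl)
    · exact hs.proj_eq_zero h hh
    · exact h0
  | basis p γ hp hγ h0 hst =>
    refine ⟨hs.insert isPersistent_genSBDone hp hγ h0
      ⟨γ, reduces_mono Set.subset_union_left hγ.1,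
        .inr ⟨h0, γ, .inr rfl, singularDivides_self γ⟩⟩, ?_⟩
    rintro α (hα | rfl) δ (hδ | rfl) hlt
    · exact hsing α hα δ hδ hlt
    -- Signatures enter in nondecreasing order, so the new element cannot spoil an older one.
    · exact absurd hlt (not_lt.2 (hs.sigMon_le_reduced hp hγ hα))
    · exact fun h => hst ((singularTopReducible_iff hs.proj_ne_zero h0).2 ⟨δ, hδ, h⟩)
    · exact absurd hlt (lt_irrefl _)
  | singular p γ hp hγ h0 hst =>
    exact ⟨hs.discard isPersistent_genSBDone subset_rfl hs.proj_eq_zero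
      ⟨γ, hγ.1, .inr ⟨h0, (singularTopReducible_iff hs.proj_ne_zero h0).1 hst⟩⟩, hsing⟩

lemma GenSBReturns.invariant {G H : Set (FreeMod σ K m)} (h : GenSBReturns f o G H) :
    Invariant f o (GenSBDone f o) ⟨G, H, ∅⟩ ∧ IsSingularReduced f o G := by
  suffices ∀ s, Relation.ReflTransGen (GenSBStep f o) ⟨∅, ∅, Set.range Pair.unit⟩ s →
      Invariant f o (GenSBDone f o) s ∧ IsSingularReduced f o s.G from this _ h
  intro s hs
  induction hs with
  | refl => exact ⟨.start fun _ h => h.elim, fun _ h => h.elim⟩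
  | tail _ h ih => exact h.invariant ih.1 ih.2

/-- Minimality of the lead monomial: if the minimal multiple were regular top reducible, the S-pair
with the reducer would yield another multiple in signature `T` with smaller lead monomial. -/
lemma GenSBReturns.exists_rewriter {G H : Set (FreeMod σ K m)} (h : GenSBReturns f o G H)
    {T : WithBot o.Mon} (hT : T ≠ ⊥) :
    SigDivisible o H T ∨ ∃ β ∈ G, ∃ b, o.shift b (o.sigMon β) = T ∧
      ¬ Red f o G (b + ord.degree (proj f β)) T := by
  have inv := h.invariant.1
  refine or_iff_not_imp_left.2 fun hH => ?_
  -- An entry whose signature divides `T` cannot have reduced to an element of `H`, as `T` is not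
  -- divisible by a signature from `H`.
  have hdone : ∀ p x, GenSBDone f o G H p → o.shift x (o.sigMon (p.val f ord)) = T →
      ∃ γ, Relation.ReflTransGen (RegularStep f o G) (p.val f ord) γ ∧ proj f γ ≠ 0 ∧
        ∃ δ ∈ G, SingularDivides f o δ γ := by
    rintro p x ⟨γ, hγ, hmem | hmem⟩ hx
    · exact absurd ⟨γ, hmem, x, by rw [sigMon_eq_of_reduces hγ, hx]⟩ hH
    · exact ⟨γ, hγ, hmem⟩
  let D : Set ord.syn := {d | ∃ β ∈ G, ∃ b, o.shift b (o.sigMon β) = T ∧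
    ord.toSyn (b + ord.degree (proj f β)) = d}
  have hne : D.Nonempty := by
    obtain ⟨i, a, hia⟩ := exists_shift_of_unit (K := K) (f := f) hT
    obtain ⟨γ, hγ, -, δ, hδ, b, -, hs⟩ :=
      hdone _ a ((inv.unit_mem i).resolve_left (Set.notMem_empty _)) hia
    exact ⟨_, δ, hδ, a + b, by rw [o.shift_add, hs, sigMon_eq_of_reduces hγ, hia], rfl⟩
  obtain ⟨d, ⟨β, hβ, b, hb, hd⟩, hmin⟩ := wellFounded_lt.has_min D hne
  refine ⟨β, hβ, b, hb, ?_⟩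
  rintro ⟨δ, hδ, c, hc, hlt⟩
  have hβ0 := inv.proj_ne_zero β hβ
  have hδ0 := inv.proj_ne_zero δ hδ
  obtain ⟨x, hx, -, hxd, hlegs, hreg⟩ := exists_regularPair hβ0 hδ0 rfl hc (hb.symm ▸ hlt)
  obtain ⟨p, hp, hpD⟩ := inv.pair_mem β hβ δ hδ hreg
  obtain ⟨γ, hγ, h0, η, hη, e, he, hs⟩ := hdone p x (hpD.resolve_left (Set.notMem_empty _))
    (by rw [hp.sigMon_val hreg hlegs, hx, hb])
  obtain ⟨hγs, hγd⟩ := hp.reduces hβ0 hδ0 hreg hlegs hγ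
  refine hmin _ ⟨η, hη, x + e, by rw [o.shift_add, hs, hγs, hx, hb], rfl⟩ ?_
  rw [← hd, ← hxd, add_assoc, he, map_add, map_add]
  exact add_lt_add_right (hγd h0) _

lemma isSigBasisAt_bot (G : Set (FreeMod σ K m)) : IsSigBasisAt f o G ⊥ :=
  fun _ hα h0 => absurd hα (sigMon_ne_bot_of_proj_ne_zero o f h0)

lemma GenSBReturns.isSigBasisAt {G H : Set (FreeMod σ K m)} (h : GenSBReturns f o G H)
    (T : WithBot o.Mon) : IsSigBasisAt f o G T := by
  have inv := h.invariant.1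
  induction T using WellFoundedLT.induction with
  | ind T ih =>
    by_cases hT : T = ⊥
    · exact hT ▸ isSigBasisAt_bot G
    exact isSigBasisAt_of_rewriter ih inv.proj_ne_zero inv.proj_eq_zero (h.exists_rewriter hT)

/-! ### Correctness of `RB` -/

/-- The entry `p` of the pair set of `RB` has been dealt with. -/
def RBDone (f : Fin m → MvPolynomial σ K) (o : ModuleOrder ord m)
    (r : FreeMod σ K m → FreeMod σ K m → Prop) (G H : Set (FreeMod σ K m))
    (p : Pair σ K m) : Prop :=
  (∃ G₀ ⊆ G, ∃ H₀ ⊆ H, p.Rewritable f o r G₀ H₀ ∧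
    ∀ α β, p = .spair α β → α ∈ G₀ ∧ β ∈ G₀) ∨
  ∃ γ, Relation.ReflTransGen (RegularStep f o G) (p.val f ord) γ ∧ γ ∈ G ∪ H

variable {r : FreeMod σ K m → FreeMod σ K m → Prop}

/-- The sets `G₀` and `H₀` at the time of the rewritability test are remembered, so later growth
does not affect the record. -/
lemma isPersistent_rbDone : IsPersistent (RBDone f o r) := by
  rintro G H G' H' p hG hH (⟨G₀, hG₀, H₀, hH₀, h⟩ | ⟨γ, hγ, h⟩)
  · exact .inl ⟨G₀, hG₀.trans hG, H₀, hH₀.trans hH, h⟩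
  · exact .inr ⟨γ, reduces_mono hG hγ, Set.union_subset_union hG hH h⟩

lemma RBStep.invariant {s s' : State σ K m} (h : RBStep f o r s s')
    (hs : Invariant f o (RBDone f o r) s) : Invariant f o (RBDone f o r) s' := by
  cases h with
  | rewritten p hp hrew =>
    refine hs.discard isPersistent_rbDone subset_rfl hs.proj_eq_zero
      (.inl ⟨s.G, subset_rfl, s.H, subset_rfl, hrew, ?_⟩)
    rintro α β rfl
    exact hs.generators α β hp.1
  | syzygy p γ hp _ hγ h0 =>
    refine hs.discard isPersistent_rbDone Set.subset_union_left ?_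
      (.inr ⟨γ, hγ.1, .inr (.inr rfl)⟩)
    rintro h (hh | rfl)
    · exact hs.proj_eq_zero h hh
    · exact h0
  | basis p γ hp _ hγ h0 =>
    exact hs.insert isPersistent_rbDone hp hγ h0
      (.inr ⟨γ, reduces_mono Set.subset_union_left hγ.1, .inl (.inr rfl)⟩)

lemma proj_single (i : Fin m) (p : MvPolynomial σ K) :
    proj f (Pi.single i p) = p * f i := by
  rw [proj, Finset.sum_eq_single i]
  · rw [Pi.single_eq_same]
  · intro j _ hj
    rw [Pi.single_eq_of_ne hj, zero_mul]
  · exact fun h => absurd (Finset.mem_univ i) h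

lemma proj_koszulSyzygies {α : FreeMod σ K m} (h : α ∈ koszulSyzygies f) : proj f α = 0 := by
  obtain ⟨i, j, -, rfl⟩ := h
  rw [proj_sub, proj_single, proj_single, mul_comm, sub_self]

lemma RBReturns.invariant {G H : Set (FreeMod σ K m)} (h : RBReturns f o r G H) :
    Invariant f o (RBDone f o r) ⟨G, H, ∅⟩ := by
  suffices ∀ s, Relation.ReflTransGen (RBStep f o r)
      ⟨∅, koszulSyzygies f, Set.range Pair.unit⟩ s → Invariant f o (RBDone f o r) s from this _ h
  intro s hs
  induction hs with
  | refl => exact .start fun _ => proj_koszulSyzygies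
  | tail _ h ih => exact h.invariant ih

lemma exists_greatest_of_finite {α : Type*} {r : α → α → Prop} {S : Set α} (hS : S.Finite)
    (hne : S.Nonempty) (htotal : ∀ x ∈ S, ∀ y ∈ S, r x y ∨ r y x)
    (htrans : ∀ x ∈ S, ∀ y ∈ S, ∀ z ∈ S, r x y → r y z → r x z) :
    ∃ x ∈ S, ∀ y ∈ S, r y x := by
  induction S, hS using Set.Finite.induction_on with
  | empty => exact absurd hne Set.not_nonempty_empty
  | @insert a S _ _ ih =>
    have ha : r a a := (htotal a (.inl rfl) a (.inl rfl)).elim id id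
    by_cases hS : S.Nonempty
    · obtain ⟨x, hx, hmax⟩ := ih hS (fun x hx y hy => htotal x (.inr hx) y (.inr hy))
        fun x hx y hy z hz => htrans x (.inr hx) y (.inr hy) z (.inr hz)
      rcases htotal a (.inl rfl) x (.inr hx) with h | h
      · refine ⟨x, .inr hx, ?_⟩
        rintro y (rfl | hy)
        · exact h
        · exact hmax y hy
      · refine ⟨a, .inl rfl, ?_⟩
        rintro y (rfl | hy)
        · exact ha
        · exact htrans y (.inr hy) x (.inr hx) a (.inl rfl) (hmax y hy) h
    · rw [Set.not_nonempty_iff_eq_empty] at hS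
      subst hS
      refine ⟨a, .inl rfl, ?_⟩
      rintro y (rfl | hy)
      · exact ha
      · exact hy.elim

/-- Every element of `G` with a multiple of signature `T` is below `β`. -/
def IsGreatestRewriter (o : ModuleOrder ord m) (r : FreeMod σ K m → FreeMod σ K m → Prop)
    (G : Set (FreeMod σ K m)) (T : WithBot o.Mon) (β : FreeMod σ K m) : Prop :=
  ∀ η ∈ G, ∀ e, o.shift e (o.sigMon η) = T → r η β

lemma exists_isGreatestRewriter {G H : Set (FreeMod σ K m)} (hG : G.Finite)
    (hr : IsRewriteOrder r G H) {T : WithBot o.Mon} (hT : SigDivisible o G T) :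
    ∃ β ∈ G, (∃ b, o.shift b (o.sigMon β) = T) ∧ IsGreatestRewriter o r G T β := by
  obtain ⟨δ, hδ, c, hc⟩ := hT
  obtain ⟨-, -, htrans, htotal⟩ := hr
  obtain ⟨β, ⟨hβ, hb⟩, hmax⟩ := exists_greatest_of_finite (r := r)
    (S := {β | β ∈ G ∧ ∃ b, o.shift b (o.sigMon β) = T}) (hG.subset fun _ h => h.1)
    ⟨δ, hδ, c, hc⟩ (fun x hx y hy => htotal x hx.1 y hy.1)
    (fun x hx y hy z hz => htrans x (.inl hx.1) y (.inl hy.1) z (.inl hz.1))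
  exact ⟨β, hβ, hb, fun η hη e he => hmax η ⟨hη, e, he⟩⟩

lemma exists_rewriter_of_not_isCanonicalRewriter {G H : Set (FreeMod σ K m)}
    {α β : FreeMod σ K m} (hα : α ∈ G) (h0 : proj f α ≠ 0)
    (h : ¬ IsCanonicalRewriter o r G H (o.sig (leg f ord α β)) α) :
    ∃ η ∈ G ∪ H, (∃ e, o.shift e (o.sigMon η) = o.sigMon (leg f ord α β)) ∧ r α η ∧ η ≠ α := by
  by_contra! hc
  refine h ⟨⟨.inl hα, _, isMonomialMultiple_leg h0 β, rfl⟩, ?_⟩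
  rintro η ⟨hη, bη, ⟨e, c, hc0, rfl⟩, hs⟩ hr
  refine hc η hη ⟨e, ?_⟩ hr
  rw [← o.sigMon_smul e hc0, ← o.sigMon_sig, hs, o.sigMon_sig]

/-- A rewriter of the leg is also one in signature `T`. Those in `H₀` are excluded by `hT`; one in
`G₀` above `α` is also below it, hence equal to it. So the test can never have rejected this leg. -/
lemma isCanonicalRewriter_of_isGreatestRewriter {G H G₀ H₀ : Set (FreeMod σ K m)}
    (hr : IsRewriteOrder r G H) (hG : G₀ ⊆ G) (hH : H₀ ⊆ H) {T : WithBot o.Mon}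
    (hT : ¬ SigDivisible o H T) {α β : FreeMod σ K m} (hα : α ∈ G₀) (h0 : proj f α ≠ 0)
    (hmax : IsGreatestRewriter o r G T α) {x : σ →₀ ℕ}
    (hx : o.shift x (o.sigMon (leg f ord α β)) = T) :
    IsCanonicalRewriter o r G₀ H₀ (o.sig (leg f ord α β)) α := by
  by_contra hc
  obtain ⟨η, hη, ⟨e, he⟩, hle, hne⟩ := exists_rewriter_of_not_isCanonicalRewriter hα h0 hc
  have hs : o.shift (x + e) (o.sigMon η) = T := by rw [o.shift_add, he, hx]
  rcases hη with hη | hη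
  · exact hne (hr.2.1 η (.inl (hG hη)) α (.inl (hG hα)) (hmax η (hG hη) _ hs) hle)
  · exact hT ⟨η, hH hη, _, hs⟩

/-- A reducible multiple of `β` is paired with the greatest rewriter `η` in the least signature `U`
among its reducers. Both legs pass the rewritability test, so the S-pair was reduced to some `γ`,
and neither `γ ∈ H` nor `γ ∈ G` is possible. -/
lemma RBReturns.not_red {G H : Set (FreeMod σ K m)} (h : RBReturns f o r G H)
    (hr : IsRewriteOrder r G H) (hadm : IsAdmissible f o r G) (T : WithBot o.Mon)
    (hbasis : ∀ S < T, IsSigBasisAt f o G S) (hT : ¬ SigDivisible o H T)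
    {β : FreeMod σ K m} (hβ : β ∈ G) {b : σ →₀ ℕ} (hb : o.shift b (o.sigMon β) = T)
    (hmax : IsGreatestRewriter o r G T β) : ¬ Red f o G (b + ord.degree (proj f β)) T := by
  have inv := h.invariant
  induction T using WellFoundedLT.induction generalizing β b with
  | ind T ih =>
    intro hred
    have hnz := inv.proj_ne_zero
    have hdeg : ∀ (b : σ →₀ ℕ) {β}, β ∈ G →
        ord.degree (proj f ((monomial b 1 : MvPolynomial σ K) • β)) = b + ord.degree (proj f β) :=
      fun b β hβ => degree_proj_monomial_smul f (one_ne_zero (α := K)) (hnz β hβ)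
    let R : Set (WithBot o.Mon) := {U | U < T ∧ ∃ δ ∈ G, ∃ c,
      c + ord.degree (proj f δ) = b + ord.degree (proj f β) ∧ o.shift c (o.sigMon δ) = U}
    have hne : R.Nonempty := by
      obtain ⟨δ, hδ, c, hc, hlt⟩ := hred
      exact ⟨_, hlt, δ, hδ, c, hc, rfl⟩
    obtain ⟨U, ⟨hUT, δ, hδ, c, hc, hU⟩, hmin⟩ := wellFounded_lt.has_min R hne
    have hbasisU : ∀ S < U, IsSigBasisAt f o G S := fun S hS => hbasis S (hS.trans hUT)
    have hδU : o.sigMon ((monomial c 1 : MvPolynomial σ K) • δ) = U :=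
      (o.sigMon_smul c one_ne_zero δ).trans hU
    have hδ0 := proj_monomial_smul_ne_zero (b := c) f (one_ne_zero (α := K)) (hnz δ hδ)
    -- A reducer of this multiple would be a reducer of the multiple of `β` with signature below
    -- `U`.
    have hδred : ¬ Red f o G (ord.degree (proj f ((monomial c 1 : MvPolynomial σ K) • δ))) U := by
      rw [hdeg c hδ, hc]
      rintro ⟨η, hη, e, he, hlt⟩
      exact hmin _ ⟨hlt.trans hUT, η, hη, e, he, rfl⟩ hlt
    have hUH : ¬ SigDivisible o H U := fun hUH =>
      hδred (red_of_sigDivisible hbasisU inv.proj_eq_zero hUH hδU hδ0)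
    obtain ⟨η, hη, ⟨e, he⟩, hηmax⟩ := exists_isGreatestRewriter inv.finite hr ⟨δ, hδ, c, hU⟩
    have hηred := ih U hUT hbasisU hUH hη he hηmax
    -- The multiples of `η` and `δ` are both irreducible in signature `U`, so their lead monomials
    -- agree and `η` can replace `δ` as reducer.
    have hηd : e + ord.degree (proj f η) = b + ord.degree (proj f β) := by
      rw [← hdeg e hη] at hηred ⊢
      rw [← hc, ← hdeg c hδ]
      exact (red_or_degree_eq hbasisU ((o.sigMon_smul e one_ne_zero η).trans he) hδU
        (proj_monomial_smul_ne_zero f one_ne_zero (hnz η hη)) hδred).resolve_left hηred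
    have hβ0 := hnz β hβ
    have hη0 := hnz η hη
    obtain ⟨x, hx, hx', hxd, hlegs, hreg⟩ := exists_regularPair hβ0 hη0 rfl hηd
      (by rw [he, hb]; exact hUT)
    obtain ⟨p, hp, hpD⟩ := inv.pair_mem β hβ η hη hreg
    rcases hpD.resolve_left (Set.notMem_empty _) with
      ⟨G₀, hG₀, H₀, hH₀, hrew, hgen⟩ | ⟨γ, hγ, hmem⟩
    · have hmem : β ∈ G₀ ∧ η ∈ G₀ := by
        rcases hp with rfl | rfl
        · exact hgen _ _ rfl
        · exact (hgen _ _ rfl).symm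
      have h1 := isCanonicalRewriter_of_isGreatestRewriter hr hG₀ hH₀ hT hmem.1 hβ0 hmax
        (hx.trans hb)
      have h2 := isCanonicalRewriter_of_isGreatestRewriter hr hG₀ hH₀ hUH hmem.2 hη0 hηmax
        (hx'.trans he)
      rcases hp with rfl | rfl
      · exact hrew.elim (fun h => h h1) fun h => h h2
      · exact hrew.elim (fun h => h h2) fun h => h h1
    · obtain ⟨hγs, hγd⟩ := hp.reduces hβ0 hη0 hreg hlegs hγ
      have hγT : o.shift x (o.sigMon γ) = T := by rw [hγs, hx, hb]
      rcases hmem with hmem | hmem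
      · have hle : r β γ := by
          rcases hp with rfl | rfl
          · exact (hadm β hβ η hη γ hmem hreg hγ).1 hlegs
          · exact (hadm η hη β hβ γ hmem hreg.symm hγ).2 hlegs
        -- Admissibility puts `γ` above `β`, maximality of `β` puts it below. Then the leg of `β`
        -- has the signature of `β`, its cofactor is constant, and the lcm is the lead monomial of
        -- `β`, against the strict drop.
        have heq := hr.2.1 β (.inl hβ) γ (.inl hmem) hle (hmax γ hmem x hγT)
        subst heq
        rw [sigMon_leg hβ0] at hγs
        have h0 : ord.degree (proj f β) ⊔ ord.degree (proj f η) - ord.degree (proj f β) = 0 := by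
          by_contra hne
          exact (o.lt_shift hne (sigMon_ne_bot_of_proj_ne_zero o f hβ0)).ne hγs
        exact absurd (ord.toSyn_monotone (tsub_eq_zero_iff_le.1 h0)) (not_le.2 (hγd hβ0))
      · exact hT ⟨γ, hmem, x, hγT⟩

lemma RBReturns.isSigBasisAt {G H : Set (FreeMod σ K m)} (h : RBReturns f o r G H)
    (hr : IsRewriteOrder r G H) (hadm : IsAdmissible f o r G) (T : WithBot o.Mon) :
    IsSigBasisAt f o G T := by
  have inv := h.invariant
  induction T using WellFoundedLT.induction with
  | ind T ih =>
    by_cases hT : T = ⊥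
    · exact hT ▸ isSigBasisAt_bot G
    refine isSigBasisAt_of_rewriter ih inv.proj_ne_zero inv.proj_eq_zero
      (or_iff_not_imp_left.2 fun hH => ?_)
    obtain ⟨i, a, hia⟩ := exists_shift_of_unit (K := K) (f := f) hT
    have hdiv : SigDivisible o G T := by
      -- Unit vectors are never rewritable, so `e_i` was reduced to an element of `G` or `H` with
      -- the same signature.
      rcases (inv.unit_mem i).resolve_left (Set.notMem_empty _) with
        ⟨-, -, -, -, ⟨⟩, -⟩ | ⟨γ, hγ, hmem⟩
      · have hs : o.shift a (o.sigMon γ) = T := by rw [sigMon_eq_of_reduces hγ, hia]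
        exact hmem.elim (fun hmem => ⟨γ, hmem, a, hs⟩) fun hmem => absurd ⟨γ, hmem, a, hs⟩ hH
    obtain ⟨β, hβ, ⟨b, hb⟩, hmax⟩ := exists_isGreatestRewriter inv.finite hr hdiv
    exact ⟨β, hβ, b, hb, h.not_red hr hadm T ih hH hβ hb hmax⟩

/-! ### Comparison -/

/-- Two regular reduced elements with the same signature have the same image, up to a scalar. -/
lemma eqUpToSigPoly_of_irreducible {G G' : Set (FreeMod σ K m)} {α β : FreeMod σ K m}
    (hG : ∀ T, IsSigBasisAt f o G T) (hG' : ∀ T, IsSigBasisAt f o G' T)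
    (hs : o.sigMon α = o.sigMon β) (h0 : o.sigMon α ≠ ⊥)
    (hα : ∀ d ∈ (proj f α).support, ¬ Red f o G d (o.sigMon α))
    (hβ : ∀ d ∈ (proj f β).support, ¬ Red f o G' d (o.sigMon β)) : EqUpToSigPoly f o α β := by
  classical
  obtain ⟨κ, hκ, hsig⟩ := o.exists_sig_eq_smul hs
  refine ⟨κ, hκ, hsig, ?_⟩
  have hlt := o.sigMon_sub_lt hsig h0
  by_contra hne
  have hne' : proj f (α - κ • β) ≠ 0 := by
    rw [proj_sub]
    exact sub_ne_zero.2 hne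
  have hd := ord.degree_mem_support hne'
  have hsub := proj_sub f α (κ • β)
  have hd : ord.degree (proj f (α - κ • β)) ∈ (proj f α - proj f (κ • β)).support := hsub ▸ hd
  -- The lead monomial of the difference is reducible and occurs in one of the two images, possibly
  -- in the tail; this is why irreducibility of all terms is assumed.
  rcases Finset.mem_union.1 (support_sub σ (proj f α) (proj f (κ • β)) hd) with hd | hd
  · exact hα _ hd (red_of_sigMon_lt (fun S _ => hG S) hlt hne')
  · rw [proj_const_smul] at hd
    have hd' := (support_smul (a := κ) (f := proj f β)) hd
    exact hβ _ hd' (red_of_sigMon_lt (fun S _ => hG' S) (hlt.trans_eq hs) hne')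

end SignatureBasis

end SigGB

end

theorem mainTheorem7 {σ : Type*} [Finite σ] {K : Type*} [Field K] {m : ℕ}
    (f : Fin m → MvPolynomial σ K) (ord : MonomialOrder σ) (o : SigGB.ModuleOrder ord m)
    (r : SigGB.FreeMod σ K m → SigGB.FreeMod σ K m → Prop)
    (G H G' H' : Set (SigGB.FreeMod σ K m))
    (hgenSB : SigGB.GenSBReturns f o G H)
    (hRB : SigGB.RBReturns f o r G' H')
    (hr : SigGB.IsRewriteOrder r G' H')
    (hadm : SigGB.IsAdmissible f o r G') :
    ∀ α ∈ G, ∃ β ∈ G', SigGB.EqUpToSigPoly f o α β := by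
  intro γ hγ
  obtain ⟨inv, hsing⟩ := hgenSB.invariant
  have inv' := hRB.invariant
  have hG := hgenSB.isSigBasisAt
  have hG' := hRB.isSigBasisAt hr hadm
  have hγ0 := inv.proj_ne_zero γ hγ
  have hbot := SigGB.sigMon_ne_bot_of_proj_ne_zero o f hγ0
  have hirr := inv.irreducible γ hγ
  have hγred := hirr _ (ord.degree_mem_support hγ0)
  obtain ⟨β, hβ, b, hd, hs⟩ := hG' _ γ rfl hγ0
  obtain ⟨δ, hδ, c, hcd, hcs⟩ := hG _ β rfl (inv'.proj_ne_zero β hβ)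
  have hle : o.shift (b + c) (o.sigMon δ) ≤ o.shift b (o.sigMon β) := by
    rw [o.shift_add]
    exact (o.shift_strictMono b).monotone hcs
  have hdeg : b + c + ord.degree (SigGB.proj f δ) = ord.degree (SigGB.proj f γ) := by
    rw [add_assoc, hcd, hd]
  -- A strict inequality would make `γ` regular top reducible by `δ`.
  have heq : o.shift (b + c) (o.sigMon δ) = o.sigMon γ :=
    (hle.trans hs).eq_of_not_lt fun hlt => hγred ⟨δ, hδ, b + c, hdeg, hlt⟩
  -- Otherwise `δ`, of smaller signature, would singular top reduce `γ`, which genSB would then not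
  -- have kept.
  have hδγ : o.sigMon δ = o.sigMon γ :=
    ((o.le_shift _ _).trans heq.le).eq_of_not_lt fun hlt =>
      hsing γ hγ δ hδ hlt ⟨b + c, hdeg, heq⟩
  refine ⟨β, hβ, SigGB.eqUpToSigPoly_of_irreducible hG hG' (le_antisymm ?_ ?_) hbot hirr
    (inv'.irreducible β hβ)⟩
  -- The signature of `β` lies between those of `δ` and `γ`, which coincide.
  · exact hδγ ▸ (o.le_shift c _).trans hcs
  · exact (o.le_shift b _).trans hs
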